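/- Let $M$ be a smooth manifold and let $A\to M$, $A^*\to M$ be a pair of dual smooth real vector bundles of finite constant rank, each carrying a Lie algebroid structure: anchors $\rho\colon A\to TM$, $\rho_*\colon A^*\to TM$ and brackets $[\cdot,\cdot]$ on $\Gamma(A)$, $[\cdot,\cdot]_*$ on $\Gamma(A^*)$. Write $\langle\cdot,\cdot\rangle$ for the pairing of $\Gamma(A)$ with $\Gamma(A^*)$. For $f\in C^\infty(M)$, $a,b\in\Gamma(A)$, $\alpha,\beta\in\Gamma(A^*)$ define $\mathrm d_Af\in\Gamma(A^*)$, $\mathcal L_a\alpha\in\Gamma(A^*)$, $\mathcal L_\alpha a\in\Gamma(A)$ and $\mathrm d_{A^*}a\in\Gamma(\wedge^2A)$ by $$\langle \mathrm d_Af,a\rangle=\rho(a)(f),\qquad \langle\mathcal L_a\alpha,b\rangle=\rho(a)\langle\alpha,b\rangle-\langle\alpha,[a,b]\rangle,\qquad \langle\mathcal L_\alpha a,\beta\rangle=\rho_*(\alpha)\langle a,\beta\rangle-\langle a,[\alpha,\beta]_*\rangle,$$ $$(\mathrm d_{A^*}a)(\alpha,\beta)=\rho_*(\alpha)\langle a,\beta\rangle-\rho_*(\beta)\langle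 a,\alpha\rangle-\langle a,[\alpha,\beta]_*\rangle.$$ The bracket of $A$ is extended to 2-vectors $P\in\Gamma(\wedge^2A)$ by the Schouten bracket, $[a,P](\alpha,\beta)=\rho(a)(P(\alpha,\beta))-P(\mathcal L_a\alpha,\beta)-P(\alpha,\mathcal L_a\beta)$ and $[P,a]=-[a,P]$. The pair $(A,A^*)$ is a Lie bialgebroid if $\mathrm d_{A^*}[a_1,a_2]=[\mathrm d_{A^*}a_1,a_2]+[a_1,\mathrm d_{A^*}a_2]$ for all $a_1,a_2\in\Gamma(A)$. Let $\mathcal S\subseteq\Gamma(A)$ be a subset which spans $\Gamma(A)$ as a $C^\infty(M)$-module, and consider the following three conditions. - (B1) $\mathrm d_{A^*}[a_1,a_2]=[\mathrm d_{A^*}a_1,a_2]+[a_1,\mathrm d_{A^*}a_2]$ for all $a_1,a_2\in\mathcal S$; - (B2) $[\rho(a),\rho_*(\alpha)](f)-\rho_*(\mathcal L_a\alpha)(f)+\rho(\mathcal L_\alpha a)(f)-\rho_*(\mathrm d_Af)\langle a,\alpha\rangle=0$ for all $a\in\mathcal S$, $\alpha\in\Gamma(A^*)$ and $f\in C^\infty(M)$;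 - (B3) $-\rho\circ\rho_*^*=\rho_*\circ\rho^*$ as maps $T^*M\to TM$, where $\rho^*\colon T^*M\to A^*$ and $\rho_*^*\colon T^*M\to A^{**}=A$ are the transposes of the anchors. If the rank of $A$ is not $1$, then $(A,A^*)$ is a Lie bialgebroid if and only if (B1), (B2) and (B3) hold. Moreover, for every rank of $A$, the conditions (B1), (B2) and (B3) together imply that $(A,A^*)$ is a Lie bialgebroid. -/

import Mathlib

open Bundle
open scoped Manifold ContDiff

namespace LieAlgd

section Basic

variable {E : Type*} [NormedAddCommGroup E] [NormedSpace ℝ E]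
  {M : Type*} [TopologicalSpace M] [ChartedSpace E M]
  {F : Type*} [NormedAddCommGroup F] [NormedSpace ℝ F]
  {V : M → Type*} [TopologicalSpace (TotalSpace F V)]
  [∀ x, AddCommGroup (V x)] [∀ x, Module ℝ (V x)] [∀ x, TopologicalSpace (V x)]
  [FiberBundle F V] [VectorBundle ℝ F V]

/-- The ring `C^∞(M)`. -/
abbrev SmoothFn (E M : Type*) [NormedAddCommGroup E] [NormedSpace ℝ E] [TopologicalSpace M]
    [ChartedSpace E M] : Type _ := C^∞⟮𝓘(ℝ, E), M; ℝ⟯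

/-- The space `Γ(V)` of smooth sections. -/
abbrev SmoothSec (E : Type*) {M : Type*} [NormedAddCommGroup E] [NormedSpace ℝ E]
    [TopologicalSpace M] [ChartedSpace E M] (F : Type*) [NormedAddCommGroup F] [NormedSpace ℝ F]
    (V : M → Type*) [TopologicalSpace (TotalSpace F V)] [∀ x, TopologicalSpace (V x)]
    [FiberBundle F V] : Type _ := Cₛ^∞⟮𝓘(ℝ, E); F, V⟯

/-- The dual bundle `V*`; its total space, with model fibre `F →L[ℝ] ℝ`, carries Mathlib's smooth
vector bundle structure of the bundle of continuous linear maps into the trivial line bundle. -/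
abbrev DualBundle {M : Type*} (V : M → Type*) [∀ x, AddCommGroup (V x)] [∀ x, Module ℝ (V x)]
    [∀ x, TopologicalSpace (V x)] : M → Type _ := fun x => V x →L[ℝ] ℝ

/-- Pointwise multiplication of a section by a function. -/
noncomputable instance instSMulSec : SMul (SmoothFn E M) (SmoothSec E F V) where
  smul f s := ⟨fun x => f x • s x, f.contMDiff.smul_section s.contMDiff⟩

@[simp] theorem smul_sec_apply (f : SmoothFn E M) (s : SmoothSec E F V) (x : M) :
    (f • s) x = f x • s x := rfl

@[simp] theorem add_sec_apply (s t : SmoothSec E F V) (x : M) : (s + t) x = s x + t x := rfl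

@[simp] theorem zero_sec_apply (x : M) : (0 : SmoothSec E F V) x = 0 := rfl

@[simp] theorem add_fn_apply (f g : SmoothFn E M) (x : M) : (f + g) x = f x + g x := rfl

@[simp] theorem mul_fn_apply (f g : SmoothFn E M) (x : M) : (f * g) x = f x * g x := rfl

noncomputable instance instModuleSec : Module (SmoothFn E M) (SmoothSec E F V) where
  one_smul s := by ext x; exact one_smul ℝ (s x)
  mul_smul f g s := by ext x; exact mul_smul (f x) (g x) (s x)
  smul_zero f := by ext x; exact smul_zero (f x)
  smul_add f s t := by ext x; exact smul_add (f x) (s x) (t x)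
  add_smul f g s := by ext x; exact add_smul (f x) (g x) (s x)
  zero_smul s := by ext x; exact zero_smul ℝ (s x)

/-- The pairing `⟨a, α⟩ ∈ C^∞(M)` of `a ∈ Γ(V)` and `α ∈ Γ(V*)`, `⟨a, α⟩(x) = α_x(a_x)`. -/
noncomputable def pairing : SmoothSec E F V →ₗ[SmoothFn E M]
    SmoothSec E (F →L[ℝ] ℝ) (DualBundle V) →ₗ[SmoothFn E M] SmoothFn E M :=
  LinearMap.mk₂ (SmoothFn E M)
    (fun a α => ⟨fun x => α x (a x), fun x => by
      have h := ContMDiffAt.clm_bundle_apply (E₂ := fun _ : M => ℝ) (α.contMDiff x) (a.contMDiff x)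
      exact (contMDiffAt_totalSpace.mp h).2⟩)
    (fun a b α => by ext x; exact map_add (α x) (a x) (b x))
    (fun f a α => by ext x; exact map_smul (α x) (f x) (a x))
    (fun a α β => by ext x; rfl)
    (fun f a α => by ext x; rfl)

@[simp] theorem pairing_apply (a : SmoothSec E F V)
    (α : SmoothSec E (F →L[ℝ] ℝ) (DualBundle V)) (x : M) : pairing a α x = α x (a x) := rfl

/-- A smooth vector bundle map `ρ : V → TM` over the identity of `M`. -/
structure Anchor (E : Type*) {M : Type*} [NormedAddCommGroup E] [NormedSpace ℝ E]
    [TopologicalSpace M] [ChartedSpace E M] [IsManifold 𝓘(ℝ, E) ∞ M]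
    (F : Type*) [NormedAddCommGroup F] [NormedSpace ℝ F]
    (V : M → Type*) [TopologicalSpace (TotalSpace F V)]
    [∀ x, AddCommGroup (V x)] [∀ x, Module ℝ (V x)] [∀ x, TopologicalSpace (V x)]
    [FiberBundle F V] [VectorBundle ℝ F V] where
  map : ∀ x : M, V x →L[ℝ] TangentSpace 𝓘(ℝ, E) x
  smooth : ContMDiff (𝓘(ℝ, E).prod 𝓘(ℝ, F)) 𝓘(ℝ, E).tangent ∞
    (fun v : TotalSpace F V => (⟨v.proj, map v.proj v.2⟩ : TangentBundle 𝓘(ℝ, E) M))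

theorem sum_sec_apply {ι : Type*} (s : Finset ι) (t : ι → SmoothSec E F V) (x : M) :
    (∑ i ∈ s, t i) x = ∑ i ∈ s, t i x := by
  classical
  induction s using Finset.induction_on with
  | empty => simp
  | insert a s ha ih => simp [Finset.sum_insert ha, ih]

theorem sum_fn_apply {ι : Type*} (s : Finset ι) (t : ι → SmoothFn E M) (x : M) :
    (∑ i ∈ s, t i) x = ∑ i ∈ s, t i x := by
  classical
  induction s using Finset.induction_on with
  | empty => simp
  | insert a s ha ih => simp [Finset.sum_insert ha, ih]

variable [IsManifold 𝓘(ℝ, E) ∞ M]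

theorem Anchor.contMDiff_deriv (ρ : Anchor E F V) (a : SmoothSec E F V) (f : SmoothFn E M) :
    ContMDiff 𝓘(ℝ, E) 𝓘(ℝ, ℝ) ∞
      (fun x => (mfderiv 𝓘(ℝ, E) 𝓘(ℝ, ℝ) f x (ρ.map x (a x)) : ℝ)) := by
  have h1 := ρ.smooth.comp a.contMDiff
  have h2 : ContMDiff 𝓘(ℝ, E).tangent 𝓘(ℝ, ℝ).tangent ∞ (tangentMap 𝓘(ℝ, E) 𝓘(ℝ, ℝ) f) :=
    f.contMDiff.contMDiff_tangentMap (by simp)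
  intro x
  have h3 := (h2.comp h1) x
  have h4 := (contMDiffAt_totalSpace.mp h3).2
  refine h4.congr_of_eventuallyEq (Filter.Eventually.of_forall fun y => ?_)
  simp [tangentMap]
  rfl

/-- The vector field `ρ(a)`, as the derivation `f ↦ (x ↦ df_x(ρ(a(x))))` of `C^∞(M)`. The bracket of
two vector fields is then the commutator of derivations. -/
noncomputable def Anchor.der (ρ : Anchor E F V) : SmoothSec E F V →ₗ[SmoothFn E M]
    Derivation ℝ (SmoothFn E M) (SmoothFn E M) where
  toFun a := Derivation.mk'
    { toFun := fun f => ⟨_, ρ.contMDiff_deriv a f⟩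
      map_add' := fun f g => by
        ext x
        have := mfderiv_add (f.contMDiff.mdifferentiableAt (x := x) (by simp))
          (g.contMDiff.mdifferentiableAt (x := x) (by simp))
        exact congrArg (fun L => L (ρ.map x (a x))) this
      map_smul' := fun c f => by
        ext x
        have := const_smul_mfderiv (f.contMDiff.mdifferentiableAt (x := x) (by simp)) c
        exact congrArg (fun L => L (ρ.map x (a x))) this }
    (fun f g => by
      ext x
      have hf := (f.contMDiff.mdifferentiableAt (x := x) (by simp)).hasMFDerivAt
      have hg := (g.contMDiff.mdifferentiableAt (x := x) (by simp)).hasMFDerivAt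
      exact congrArg (fun L => L (ρ.map x (a x))) (hf.mul hg).mfderiv)
  map_add' a b := by
    ext f x
    exact (congrArg _ (map_add (ρ.map x) (a x) (b x))).trans
      (map_add (mfderiv 𝓘(ℝ, E) 𝓘(ℝ, ℝ) f x) _ _)
  map_smul' g a := by
    ext f x
    exact (congrArg _ (map_smul (ρ.map x) (g x) (a x))).trans
      (map_smul (mfderiv 𝓘(ℝ, E) 𝓘(ℝ, ℝ) f x) _ _)


/-- The transpose `ρ^* : T*M → V*` of an anchor, at a point. -/
noncomputable def Anchor.transpose (ρ : Anchor E F V) (x : M) (ξ : TangentSpace 𝓘(ℝ, E) x →L[ℝ] ℝ) :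
    V x →L[ℝ] ℝ := ξ.comp (ρ.map x)

end Basic

theorem sum_frame {M : Type*} [TopologicalSpace M]
    {F : Type*} [NormedAddCommGroup F] [NormedSpace ℝ F] [FiniteDimensional ℝ F]
    {V : M → Type*} [TopologicalSpace (TotalSpace F V)]
    [∀ x, AddCommGroup (V x)] [∀ x, Module ℝ (V x)] [∀ x, TopologicalSpace (V x)]
    [FiberBundle F V] [VectorBundle ℝ F V] (x₀ : M) {x : M} (hx : x ∈ (trivializationAt F V x₀).baseSet) (v : V x) :
    ∑ i, (Module.finBasis ℝ F).repr ((trivializationAt F V x₀) ⟨x, v⟩).2 i •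
      (trivializationAt F V x₀).symm x (Module.finBasis ℝ F i) = v := by
  set e := trivializationAt F V x₀
  have h2 (w : F) : ∑ i, (Module.finBasis ℝ F).repr w i • e.symm x (Module.finBasis ℝ F i) =
      e.symmL ℝ x (∑ i, (Module.finBasis ℝ F).repr w i • (Module.finBasis ℝ F i)) := by
    rw [map_sum]
    exact Finset.sum_congr rfl fun i _ => by rw [map_smul, e.symmL_apply hx]
  rw [h2, Module.Basis.sum_repr, e.symmL_apply hx]
  simpa using e.symm_proj_apply ⟨x, v⟩ hx

theorem coeff_contMDiffAt {E : Type*} [NormedAddCommGroup E] [NormedSpace ℝ E]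
    {M : Type*} [TopologicalSpace M] [ChartedSpace E M]
    {F : Type*} [NormedAddCommGroup F] [NormedSpace ℝ F] [FiniteDimensional ℝ F]
    {V : M → Type*} [TopologicalSpace (TotalSpace F V)]
    [∀ x, AddCommGroup (V x)] [∀ x, Module ℝ (V x)] [∀ x, TopologicalSpace (V x)]
    [FiberBundle F V] [VectorBundle ℝ F V] [ContMDiffVectorBundle ∞ F V 𝓘(ℝ, E)] (x₀ : M) {x : M} (hx : x ∈ (trivializationAt F V x₀).baseSet)
    (s : SmoothSec E F V) (i : Fin (Module.finrank ℝ F)) :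
    ContMDiffAt 𝓘(ℝ, E) 𝓘(ℝ, ℝ) ∞ (fun y =>
      (Module.finBasis ℝ F).repr ((trivializationAt F V x₀) ⟨y, s y⟩).2 i) x := by
  have h1 := ((trivializationAt F V x₀).contMDiffAt_section_iff (IB := 𝓘(ℝ, E)) (n := ∞) hx).1
    (s.contMDiff x)
  let L : F →L[ℝ] ℝ := LinearMap.toContinuousLinearMap ((Module.finBasis ℝ F).coord i)
  exact L.contMDiff.contMDiffAt.comp x h1


/-- The fibrewise evaluation pairing. -/
def fiberPairing {M : Type*} (V : M → Type*) [∀ x, AddCommGroup (V x)] [∀ x, Module ℝ (V x)]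
    [∀ x, TopologicalSpace (V x)] (x : M) : V x →ₗ[ℝ] (V x →L[ℝ] ℝ) →ₗ[ℝ] ℝ :=
  LinearMap.mk₂ ℝ (fun v α => α v) (fun v w α => map_add α v w) (fun c v α => map_smul α c v)
    (fun _ _ _ => rfl) (fun _ _ _ => rfl)

@[simp] theorem fiberPairing_apply {M : Type*} {V : M → Type*}
    [∀ x, AddCommGroup (V x)] [∀ x, Module ℝ (V x)] [∀ x, TopologicalSpace (V x)] (x : M) (v : V x) (α : V x →L[ℝ] ℝ) :
    fiberPairing V x v α = α v := rfl

variable (F) in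
theorem fiberPairing_isPerfPair {M : Type*} [TopologicalSpace M] (F : Type*)
    [NormedAddCommGroup F] [NormedSpace ℝ F] [FiniteDimensional ℝ F]
    {V : M → Type*} [TopologicalSpace (TotalSpace F V)]
    [∀ x, AddCommGroup (V x)] [∀ x, Module ℝ (V x)] [∀ x, TopologicalSpace (V x)]
    [FiberBundle F V] [VectorBundle ℝ F V] (x : M) : (fiberPairing V x).IsPerfPair := by
  have : T2Space (V x) := FiberBundle.t2Space F V x
  have : FiniteDimensional ℝ (V x) := VectorBundle.finiteDimensional ℝ F V x
  have : IsTopologicalAddGroup (V x) :=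
    (VectorBundle.continuousLinearEquivAt ℝ F V x).toContinuousAddEquiv.isTopologicalAddGroup
  have : ContinuousSMul ℝ (V x) := (VectorBundle.continuousLinearEquivAt ℝ F V x).continuousSMul
  refine LinearMap.IsPerfPair.of_injective ?_ ?_
  · refine (injective_iff_map_eq_zero _).2 fun v hv => ?_
    refine (Module.forall_dual_apply_eq_zero_iff ℝ v).1 fun φ => ?_
    exact congrArg (fun L => L (LinearMap.toContinuousLinearMap φ)) hv
  · refine (injective_iff_map_eq_zero _).2 fun α hα => ?_
    ext v
    exact congrArg (fun L => L v) hα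

/-- The canonical identification `(V_x)** = V_x`: `v = bidualToFiber F x Φ` is the vector with
`Φ(α) = α(v)` for all `α`. -/
noncomputable def bidualToFiber {M : Type*} [TopologicalSpace M] (F : Type*)
    [NormedAddCommGroup F] [NormedSpace ℝ F] [FiniteDimensional ℝ F]
    {V : M → Type*} [TopologicalSpace (TotalSpace F V)]
    [∀ x, AddCommGroup (V x)] [∀ x, Module ℝ (V x)] [∀ x, TopologicalSpace (V x)]
    [FiberBundle F V] [VectorBundle ℝ F V] (x : M) (Φ : (V x →L[ℝ] ℝ) →L[ℝ] ℝ) : V x :=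
  haveI := fiberPairing_isPerfPair F (V := V) x
  (fiberPairing V x).toPerfPair.symm Φ.toLinearMap

theorem apply_bidualToFiber {M : Type*} [TopologicalSpace M] (F : Type*)
    [NormedAddCommGroup F] [NormedSpace ℝ F] [FiniteDimensional ℝ F]
    {V : M → Type*} [TopologicalSpace (TotalSpace F V)]
    [∀ x, AddCommGroup (V x)] [∀ x, Module ℝ (V x)] [∀ x, TopologicalSpace (V x)]
    [FiberBundle F V] [VectorBundle ℝ F V] (x : M) (Φ : (V x →L[ℝ] ℝ) →L[ℝ] ℝ)
    (α : V x →L[ℝ] ℝ) : α (bidualToFiber F x Φ) = Φ α :=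
  haveI := fiberPairing_isPerfPair F (V := V) x
  congrArg (fun L => L α) ((fiberPairing V x).apply_symm_toPerfPair_self Φ.toLinearMap)

section Duality

variable {E : Type*} [NormedAddCommGroup E] [NormedSpace ℝ E] [FiniteDimensional ℝ E]
  {M : Type*} [TopologicalSpace M] [ChartedSpace E M] [T2Space M]
  {F : Type*} [NormedAddCommGroup F] [NormedSpace ℝ F] [FiniteDimensional ℝ F]
  {V : M → Type*} [TopologicalSpace (TotalSpace F V)]
  [∀ x, AddCommGroup (V x)] [∀ x, Module ℝ (V x)] [∀ x, TopologicalSpace (V x)]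
  [FiberBundle F V] [VectorBundle ℝ F V]

theorem exists_cutoff {x₀ : M} {u : Set M} (hu : u ∈ nhds x₀) [IsManifold 𝓘(ℝ, E) ∞ M] :
    ∃ χ : SmoothFn E M, (∀ᶠ x in nhds x₀, χ x = 1) ∧ tsupport χ ⊆ u := by
  obtain ⟨f, -, hf⟩ := (SmoothBumpFunction.nhds_basis_tsupport (I := 𝓘(ℝ, E)) x₀).mem_iff.1 hu
  exact ⟨⟨f, f.contMDiff⟩, f.eventuallyEq_one, hf⟩

variable [IsManifold 𝓘(ℝ, E) ∞ M] [ContMDiffVectorBundle ∞ F V 𝓘(ℝ, E)]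

variable (E F V) in
/-- Near any point there is a frame made of global sections. -/
theorem exists_frame (x₀ : M) : ∃ (S : Fin (Module.finrank ℝ F) → SmoothSec E F V),
    ∀ᶠ x in nhds x₀, x ∈ (trivializationAt F V x₀).baseSet ∧
      ∀ i, S i x = (trivializationAt F V x₀).symm x (Module.finBasis ℝ F i) := by
  set e := trivializationAt F V x₀
  have hx₀ : e.baseSet ∈ nhds x₀ :=
    e.open_baseSet.mem_nhds (FiberBundle.mem_baseSet_trivializationAt F V x₀)
  obtain ⟨χ, hχ, hs⟩ := exists_cutoff (E := E) hx₀
  have hsm (i) : ContMDiffOn 𝓘(ℝ, E) (𝓘(ℝ, E).prod 𝓘(ℝ, F)) ∞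
      (fun x => (⟨x, e.symm x (Module.finBasis ℝ F i)⟩ : TotalSpace F V)) e.baseSet := by
    rw [e.contMDiffOn_section_baseSet_iff]
    refine (contMDiffOn_const (c := Module.finBasis ℝ F i)).congr fun y hy => ?_
    exact congrArg Prod.snd (e.apply_mk_symm hy _)
  refine ⟨fun i => ⟨fun x => (χ x • e.symm x (Module.finBasis ℝ F i) : V x),
    ContMDiffOn.smul_section_of_tsupport (ψ := χ)
      (s := fun x => e.symm x (Module.finBasis ℝ F i)) χ.contMDiff.contMDiffOn e.open_baseSet hs
      (hsm i)⟩, ?_⟩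
  filter_upwards [hχ, hx₀] with x h1 h2
  refine ⟨h2, fun i => ?_⟩
  change χ x • e.symm x (Module.finBasis ℝ F i) = _
  rw [h1, one_smul]

/-- A smooth function near `x₀` agrees near `x₀` with a global one. -/
theorem exists_fn {x₀ : M} {f : M → ℝ} {u : Set M} (hu : IsOpen u) (hx₀ : x₀ ∈ u)
    (hf : ∀ x ∈ u, ContMDiffAt 𝓘(ℝ, E) 𝓘(ℝ, ℝ) ∞ f x) :
    ∃ g : SmoothFn E M, ∀ᶠ x in nhds x₀, g x = f x := by
  obtain ⟨χ, hχ, hs⟩ := exists_cutoff (E := E) (hu.mem_nhds hx₀)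
  refine ⟨⟨fun x => χ x * f x, contMDiff_of_tsupport fun x hx => ?_⟩, ?_⟩
  · exact (χ.contMDiff x).mul (hf x (hs (tsupport_mul_subset_left hx)))
  · filter_upwards [hχ] with x h
    change χ x * f x = f x
    rw [h, one_mul]

theorem exists_sec_eq (x₀ : M) (v : V x₀) : ∃ s : SmoothSec E F V, s x₀ = v := by
  obtain ⟨S, hS⟩ := exists_frame E F V x₀
  obtain ⟨h0, hS⟩ := hS.self_of_nhds
  refine ⟨∑ i, (Module.finBasis ℝ F).repr ((trivializationAt F V x₀) ⟨x₀, v⟩).2 i • S i, ?_⟩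
  rw [sum_sec_apply]
  refine Eq.trans (Finset.sum_congr rfl fun i _ => ?_) (sum_frame x₀ h0 v)
  rw [← hS i]
  rfl

theorem apply_eq_zero_of_eq_zero (φ : SmoothSec E F V →ₗ[SmoothFn E M] SmoothFn E M)
    (s : SmoothSec E F V) (x₀ : M) (hs : s x₀ = 0) : φ s x₀ = 0 := by
  obtain ⟨S, hS⟩ := exists_frame E F V x₀
  set e := trivializationAt F V x₀ with he
  have h0 := hS.self_of_nhds.1
  choose g hg using fun i => exists_fn (E := E) (u := e.baseSet) e.open_baseSet h0
    (fun x hx => coeff_contMDiffAt x₀ hx s i)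
  have hg' := Filter.eventually_all.2 hg
  obtain ⟨η, h1, h2⟩ := exists_cutoff (E := E) (hS.and hg')
  have key : η • s = ∑ i, (η * g i) • S i := by
    ext x
    rw [sum_sec_apply]
    by_cases hx : x ∈ tsupport η
    · obtain ⟨⟨hx1, hx2⟩, hx3⟩ := h2 hx
      simp only [smul_sec_apply, mul_smul, hx2, hx3, ← Finset.smul_sum]
      rw [sum_frame x₀ hx1]
    · simp [image_eq_zero_of_notMem_tsupport hx]
  have h3 := congrArg (fun t => φ t x₀) key
  simp only [map_sum, map_smul, sum_fn_apply, smul_eq_mul, mul_fn_apply] at h3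
  rw [h1.self_of_nhds, one_mul] at h3
  rw [h3]
  refine Finset.sum_eq_zero fun i _ => ?_
  have hz : (e ⟨x₀, s x₀⟩).2 = 0 := by
    rw [hs]
    exact map_zero (e.linearMapAt ℝ x₀) ▸ (congrFun (e.coe_linearMapAt_of_mem (R := ℝ) h0) 0).symm
  rw [(hg i).self_of_nhds, hz]
  simp

/-- A `C^∞(M)`-linear functional on sections is given by a fibrewise linear functional. -/
theorem exists_pointwise (φ : SmoothSec E F V →ₗ[SmoothFn E M] SmoothFn E M) :
    ∃ ψ : ∀ x, V x →L[ℝ] ℝ, ∀ (s : SmoothSec E F V) (x : M), ψ x (s x) = φ s x := by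
  choose ext hext using fun (x : M) (v : V x) => exists_sec_eq (E := E) (F := F) x v
  have hφ (s t : SmoothSec E F V) (x : M) (h : s x = t x) : φ s x = φ t x := by
    have h1 := apply_eq_zero_of_eq_zero φ (s - t) x (by
      rw [ContMDiffSection.coe_sub]; simp [h])
    rw [map_sub] at h1
    exact sub_eq_zero.1 h1
  have hT2 (x : M) : T2Space (V x) := FiberBundle.t2Space F V x
  have hFD (x : M) : FiniteDimensional ℝ (V x) := VectorBundle.finiteDimensional ℝ F V x
  have hTG (x : M) : IsTopologicalAddGroup (V x) :=
    (VectorBundle.continuousLinearEquivAt ℝ F V x).toContinuousAddEquiv.isTopologicalAddGroup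
  have hCS (x : M) : ContinuousSMul ℝ (V x) :=
    (VectorBundle.continuousLinearEquivAt ℝ F V x).continuousSMul
  refine ⟨fun x => LinearMap.toContinuousLinearMap
    { toFun := fun v => φ (ext x v) x
      map_add' := fun v w => ?_
      map_smul' := fun c v => ?_ }, fun s x => ?_⟩
  · rw [hφ _ (ext x v + ext x w) x (by simp [hext]), map_add]
    rfl
  · rw [hφ _ ((ContMDiffMap.const c : SmoothFn E M) • ext x v) x (by simp [hext]; rfl), map_smul]
    rfl
  · exact hφ _ _ x (hext x (s x))

/-- A pointwise form is smooth if it is smooth on all smooth sections. -/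
theorem contMDiff_form (α : ∀ x, V x →L[ℝ] ℝ)
    (h : ∀ s : SmoothSec E F V, ContMDiff 𝓘(ℝ, E) 𝓘(ℝ, ℝ) ∞ (fun x => α x (s x))) :
    ContMDiff 𝓘(ℝ, E) (𝓘(ℝ, E).prod 𝓘(ℝ, F →L[ℝ] ℝ)) ∞
      (fun x => (⟨x, α x⟩ : TotalSpace (F →L[ℝ] ℝ) (DualBundle V))) := by
  intro x₀
  refine (contMDiffAt_hom_bundle (E₂ := fun _ : M => ℝ) (F₂ := ℝ) _).2 ⟨contMDiffAt_id, ?_⟩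
  obtain ⟨S, hS⟩ := exists_frame E F V x₀
  let L (i : Fin (Module.finrank ℝ F)) : F →L[ℝ] ℝ :=
    LinearMap.toContinuousLinearMap ((Module.finBasis ℝ F).coord i)
  have h1 : ContMDiffAt 𝓘(ℝ, E) 𝓘(ℝ, F →L[ℝ] ℝ) ∞ (fun x => ∑ i, α x (S i x) • L i) x₀ :=
    ContMDiffAt.sum fun i _ => (h (S i) x₀).smul contMDiffAt_const
  refine h1.congr_of_eventuallyEq ?_
  filter_upwards [hS] with x hx
  refine ContinuousLinearMap.coe_injective ((Module.finBasis ℝ F).ext fun j => ?_)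
  have hα : ContinuousLinearMap.inCoordinates F V ℝ (fun _ : M => ℝ) x₀ x x₀ x (α x)
      (Module.finBasis ℝ F j) = α x (S j x) := by
    rw [hx.2 j, ContinuousLinearMap.inCoordinates_eq hx.1 (by simp)]
    simp
  refine hα.trans ?_
  simp [L, Finsupp.single_apply]

/-- A pointwise section is smooth if its pairing with all smooth forms is. -/
theorem contMDiff_sec (a : ∀ x, V x)
    (h : ∀ α : SmoothSec E (F →L[ℝ] ℝ) (DualBundle V),
      ContMDiff 𝓘(ℝ, E) 𝓘(ℝ, ℝ) ∞ (fun x => α x (a x))) :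
    ContMDiff 𝓘(ℝ, E) (𝓘(ℝ, E).prod 𝓘(ℝ, F)) ∞ (fun x => (⟨x, a x⟩ : TotalSpace F V)) := by
  intro x₀
  set e := trivializationAt F V x₀ with he
  have h0 : x₀ ∈ e.baseSet := FiberBundle.mem_baseSet_trivializationAt F V x₀
  rw [e.contMDiffAt_section_iff h0]
  obtain ⟨χ, h1, h2⟩ := exists_cutoff (E := E) (e.open_baseSet.mem_nhds h0)
  let L (i : Fin (Module.finrank ℝ F)) : F →L[ℝ] ℝ :=
    LinearMap.toContinuousLinearMap ((Module.finBasis ℝ F).coord i)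
  let α (i : Fin (Module.finrank ℝ F)) : SmoothSec E (F →L[ℝ] ℝ) (DualBundle V) :=
    ⟨fun x => χ x • (L i).comp (e.continuousLinearMapAt ℝ x), contMDiff_form _ fun s =>
      contMDiff_of_tsupport fun x hx => by
        have hx' : x ∈ e.baseSet := h2 (tsupport_mul_subset_left (f := χ) hx)
        refine ((χ.contMDiff x).mul (coeff_contMDiffAt x₀ hx' s i)).congr_of_eventuallyEq ?_
        filter_upwards [e.open_baseSet.mem_nhds hx'] with y hy
        change χ y * (L i) (e.continuousLinearMapAt ℝ y (s y)) = _
        rw [e.continuousLinearMapAt_apply ℝ, e.coe_linearMapAt_of_mem hy]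
        rfl⟩
  have h3 : ContMDiffAt 𝓘(ℝ, E) 𝓘(ℝ, F) ∞ (fun x => ∑ i, α i x (a x) • Module.finBasis ℝ F i) x₀ :=
    ContMDiffAt.sum fun i _ => (h (α i) x₀).smul contMDiffAt_const
  refine h3.congr_of_eventuallyEq ?_
  filter_upwards [h1, e.open_baseSet.mem_nhds h0] with x hx1 hx2
  have h4 (i) : α i x (a x) = (Module.finBasis ℝ F).repr (e ⟨x, a x⟩).2 i := by
    change χ x • (L i) (e.continuousLinearMapAt ℝ x (a x)) = _
    rw [hx1, one_smul]
    rw [e.continuousLinearMapAt_apply ℝ, e.coe_linearMapAt_of_mem hx2]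
    rfl
  simp only [h4]
  exact ((Module.finBasis ℝ F).sum_repr _).symm

/-- The pairing of `Γ(V)` and `Γ(V*)` is perfect. -/
instance pairing_isPerfPair : (pairing (E := E) (F := F) (V := V)).IsPerfPair where
  bijective_left := by
    refine ⟨(injective_iff_map_eq_zero _).2 fun a ha => ?_, fun φ => ?_⟩
    · ext x
      refine (injective_iff_map_eq_zero (fiberPairing V x)).1
        (fiberPairing_isPerfPair F x).bijective_left.1 (a x) ?_
      ext α
      obtain ⟨s, rfl⟩ := exists_sec_eq (E := E) (F := F →L[ℝ] ℝ) (V := DualBundle V) x α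
      exact congrArg (fun L => L s x) ha
    · obtain ⟨ψ, hψ⟩ := exists_pointwise φ
      choose a ha using fun x => 
        (fiberPairing_isPerfPair F (V := V) x).bijective_left.2 (ψ x).toLinearMap
      have ha' (x) (α : V x →L[ℝ] ℝ) : α (a x) = ψ x α := congrArg (fun L => L α) (ha x)
      refine ⟨⟨a, contMDiff_sec a fun α => ?_⟩, ?_⟩
      · simp only [ha', hψ]
        exact (φ α).contMDiff
      · ext α x
        exact (ha' x (α x)).trans (hψ α x)
  bijective_right := by
    refine ⟨(injective_iff_map_eq_zero _).2 fun α hα => ?_, fun φ => ?_⟩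
    · ext x v
      obtain ⟨s, rfl⟩ := exists_sec_eq (E := E) (F := F) (V := V) x v
      exact congrArg (fun L => L s x) hα
    · obtain ⟨ψ, hψ⟩ := exists_pointwise φ
      refine ⟨⟨ψ, contMDiff_form ψ fun s => ?_⟩, ?_⟩
      · simp only [hψ]
        exact (φ s).contMDiff
      · ext s x
        exact hψ s x

end Duality

section Alternating

variable {R N : Type*} [CommRing R] [AddCommGroup N] [Module R N]

/-- The alternating map `(m, n) ↦ B(m, n)` given by an alternating bilinear form. -/
def altOfBilin (B : N →ₗ[R] N →ₗ[R] R) (hB : ∀ n, B n n = 0) : N [⋀^Fin 2]→ₗ[R] R where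
  toFun v := B (v 0) (v 1)
  map_update_add' v i x y := by
    fin_cases i <;> simp
  map_update_smul' v i c x := by
    fin_cases i <;> simp
  map_eq_zero_of_eq' v i j h hij := by
    fin_cases i <;> fin_cases j <;> simp_all

@[simp] theorem altOfBilin_apply (B : N →ₗ[R] N →ₗ[R] R) (hB : ∀ n, B n n = 0) (m n : N) :
    altOfBilin B hB ![m, n] = B m n := rfl

theorem vec_update_zero {X : Type*} (a b c : X) : Function.update ![a, b] 0 c = ![c, b] := by
  ext i
  fin_cases i <;> rfl

theorem vec_update_one {X : Type*} (a b c : X) : Function.update ![a, b] 1 c = ![a, c] := by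
  ext i
  fin_cases i <;> rfl

theorem alt_add_left (P : N [⋀^Fin 2]→ₗ[R] R) (m m' n : N) :
    P ![m + m', n] = P ![m, n] + P ![m', n] := by
  have h := P.map_update_add ![m, n] 0 m m'
  simpa only [vec_update_zero] using h

theorem alt_smul_left (P : N [⋀^Fin 2]→ₗ[R] R) (c : R) (m n : N) :
    P ![c • m, n] = c • P ![m, n] := by
  have h := P.map_update_smul ![m, n] 0 c m
  simpa only [vec_update_zero] using h

theorem alt_add_right (P : N [⋀^Fin 2]→ₗ[R] R) (m n n' : N) :
    P ![m, n + n'] = P ![m, n] + P ![m, n'] := by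
  have h := P.map_update_add ![m, n] 1 n n'
  simpa only [vec_update_one] using h

theorem alt_smul_right (P : N [⋀^Fin 2]→ₗ[R] R) (c : R) (m n : N) :
    P ![m, c • n] = c • P ![m, n] := by
  have h := P.map_update_smul ![m, n] 1 c n
  simpa only [vec_update_one] using h

theorem alt_self (P : N [⋀^Fin 2]→ₗ[R] R) (n : N) : P ![n, n] = 0 :=
  P.map_eq_zero_of_eq ![n, n] (i := 0) (j := 1) rfl (by decide)

theorem alt_skew (P : N [⋀^Fin 2]→ₗ[R] R) (m n : N) : P ![m, n] = -P ![n, m] := by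
  have h := alt_self P (m + n)
  rw [alt_add_left, alt_add_right, alt_add_right, alt_self, alt_self, zero_add, add_zero] at h
  exact eq_neg_of_add_eq_zero_left h

end Alternating

section Algebroid

/-- A Lie algebroid structure on `V → M`: an `ℝ`-bilinear alternating bracket on `Γ(V)` satisfying
the Jacobi identity, and an anchor `V → TM`, related by the Leibniz rule
`[a, f b] = f [a, b] + ρ(a)(f) b`. -/
structure LieAlgebroid (E : Type*) {M : Type*} [NormedAddCommGroup E] [NormedSpace ℝ E]
    [TopologicalSpace M] [ChartedSpace E M] [IsManifold 𝓘(ℝ, E) ∞ M]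
    (F : Type*) [NormedAddCommGroup F] [NormedSpace ℝ F]
    (V : M → Type*) [TopologicalSpace (TotalSpace F V)]
    [∀ x, AddCommGroup (V x)] [∀ x, Module ℝ (V x)] [∀ x, TopologicalSpace (V x)]
    [FiberBundle F V] [VectorBundle ℝ F V] where
  anchor : Anchor E F V
  bracket : SmoothSec E F V →ₗ[ℝ] SmoothSec E F V →ₗ[ℝ] SmoothSec E F V
  bracket_self : ∀ a, bracket a a = 0
  jacobi : ∀ a b c, bracket a (bracket b c) = bracket (bracket a b) c + bracket b (bracket a c)
  leibniz : ∀ (a b : SmoothSec E F V) (f : SmoothFn E M),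
    bracket a (f • b) = f • bracket a b + anchor.der a f • b

variable {E : Type*} [NormedAddCommGroup E] [NormedSpace ℝ E]
  {M : Type*} [TopologicalSpace M] [ChartedSpace E M] [IsManifold 𝓘(ℝ, E) ∞ M]
  {F : Type*} [NormedAddCommGroup F] [NormedSpace ℝ F]
  {V : M → Type*} [TopologicalSpace (TotalSpace F V)]
  [∀ x, AddCommGroup (V x)] [∀ x, Module ℝ (V x)] [∀ x, TopologicalSpace (V x)]
  [FiberBundle F V] [VectorBundle ℝ F V]
  {N : Type*} [AddCommGroup N] [Module (SmoothFn E M) N]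

namespace LieAlgebroid

variable (L : LieAlgebroid E F V)

theorem bracket_skew (a b : SmoothSec E F V) : L.bracket b a = -L.bracket a b := by
  have h := L.bracket_self (a + b)
  simp only [map_add, LinearMap.add_apply, L.bracket_self, zero_add, add_zero] at h
  exact eq_neg_of_add_eq_zero_left h

theorem smul_bracket (a b : SmoothSec E F V) (f : SmoothFn E M) :
    L.bracket (f • a) b = f • L.bracket a b - L.anchor.der b f • a := by
  rw [L.bracket_skew b (f • a), L.leibniz, L.bracket_skew a b]
  module

/- Below, `p` is a perfect pairing of `Γ(V)` with a `C^∞(M)`-module `N`, so that `N` is the module of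
`1`-forms on `V`. For a Lie algebroid structure on `A` this is used with `N = Γ(A*)`, and for one on
`A*` with `N = Γ(A)`. -/

/-- The Lie algebroid differential `d f` of a function, the `1`-form with `(d f)(a) = ρ(a)(f)`. -/
noncomputable def dFn (p : SmoothSec E F V →ₗ[SmoothFn E M] N →ₗ[SmoothFn E M] SmoothFn E M)
    [p.IsPerfPair] (f : SmoothFn E M) : N :=
  p.flip.toPerfPair.symm
    { toFun := fun a => L.anchor.der a f
      map_add' := fun a b => by simp
      map_smul' := fun g a => by simp }

theorem pairing_dFn (p : SmoothSec E F V →ₗ[SmoothFn E M] N →ₗ[SmoothFn E M] SmoothFn E M)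
    [p.IsPerfPair] (f : SmoothFn E M) (a : SmoothSec E F V) :
    p a (L.dFn p f) = L.anchor.der a f :=
  p.apply_toPerfPair_flip _ a

/-- The Lie derivative `£_a n` of a `1`-form: `⟨£_a n, b⟩ = ρ(a)⟨n, b⟩ - ⟨n, [a, b]⟩`. -/
noncomputable def lieDeriv (p : SmoothSec E F V →ₗ[SmoothFn E M] N →ₗ[SmoothFn E M] SmoothFn E M)
    [p.IsPerfPair] (a : SmoothSec E F V) (n : N) : N :=
  p.flip.toPerfPair.symm
    { toFun := fun b => L.anchor.der a (p b n) - p (L.bracket a b) n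
      map_add' := fun b c => by
        simp only [map_add, LinearMap.add_apply]
        abel
      map_smul' := fun f b => by
        simp only [L.leibniz, map_add, map_smul, LinearMap.add_apply, LinearMap.smul_apply,
          smul_eq_mul, Derivation.leibniz, RingHom.id_apply]
        ring }

theorem pairing_lieDeriv
    (p : SmoothSec E F V →ₗ[SmoothFn E M] N →ₗ[SmoothFn E M] SmoothFn E M)
    [p.IsPerfPair] (a b : SmoothSec E F V) (n : N) :
    p b (L.lieDeriv p a n) = L.anchor.der a (p b n) - p (L.bracket a b) n :=
  p.apply_toPerfPair_flip _ b

theorem lieDeriv_add (p : SmoothSec E F V →ₗ[SmoothFn E M] N →ₗ[SmoothFn E M] SmoothFn E M)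
    [p.IsPerfPair] (a : SmoothSec E F V) (m n : N) :
    L.lieDeriv p a (m + n) = L.lieDeriv p a m + L.lieDeriv p a n := by
  refine p.flip.toPerfPair.injective (LinearMap.ext fun b => ?_)
  change p b (L.lieDeriv p a (m + n)) = p b (L.lieDeriv p a m + L.lieDeriv p a n)
  simp only [map_add, L.pairing_lieDeriv]
  abel

theorem lieDeriv_smul (p : SmoothSec E F V →ₗ[SmoothFn E M] N →ₗ[SmoothFn E M] SmoothFn E M)
    [p.IsPerfPair] (a : SmoothSec E F V) (f : SmoothFn E M) (n : N) :
    L.lieDeriv p a (f • n) = f • L.lieDeriv p a n + L.anchor.der a f • n := by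
  refine p.flip.toPerfPair.injective (LinearMap.ext fun b => ?_)
  change p b (L.lieDeriv p a (f • n)) = p b (f • L.lieDeriv p a n + L.anchor.der a f • n)
  simp only [map_add, map_smul, L.pairing_lieDeriv, smul_eq_mul, Derivation.leibniz]
  ring

/-- The Lie algebroid differential of a `1`-form `n`, as an alternating `2`-form on `Γ(V)`:
`(d n)(a, b) = ρ(a)⟨n, b⟩ - ρ(b)⟨n, a⟩ - ⟨n, [a, b]⟩`. -/
noncomputable def dForm (p : SmoothSec E F V →ₗ[SmoothFn E M] N →ₗ[SmoothFn E M] SmoothFn E M)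
    (n : N) : SmoothSec E F V [⋀^Fin 2]→ₗ[SmoothFn E M] SmoothFn E M :=
  altOfBilin
    (LinearMap.mk₂ (SmoothFn E M)
      (fun a b => L.anchor.der a (p b n) - L.anchor.der b (p a n) - p (L.bracket a b) n)
      (fun a a' b => by
        simp only [map_add, LinearMap.add_apply, Derivation.add_apply]
        abel)
      (fun f a b => by
        simp only [L.smul_bracket, map_sub, map_smul, LinearMap.sub_apply, LinearMap.smul_apply,
          smul_eq_mul, Derivation.leibniz, Derivation.smul_apply]
        ring)
      (fun a b b' => by
        simp only [map_add, LinearMap.add_apply, Derivation.add_apply]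
        abel)
      (fun f a b => by
        simp only [L.leibniz, map_add, map_smul, LinearMap.add_apply, LinearMap.smul_apply,
          smul_eq_mul, Derivation.leibniz, Derivation.smul_apply]
        ring))
    (fun a => by simp [L.bracket_self])

/-- The Schouten bracket `[a, P]` of `a ∈ Γ(V)` with a `2`-vector `P ∈ Γ(Λ² V)`, the latter given
as an alternating `2`-form on `N ≅ Γ(V*)`. It is the Lie derivative of `P`, the unique extension of
`[a, ·]` with `[a, b ∧ c] = [a, b] ∧ c + b ∧ [a, c]`:
`[a, P](m, n) = ρ(a)(P(m, n)) - P(£_a m, n) - P(m, £_a n)`. -/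
noncomputable def schouten (p : SmoothSec E F V →ₗ[SmoothFn E M] N →ₗ[SmoothFn E M] SmoothFn E M)
    [p.IsPerfPair] (a : SmoothSec E F V) (P : N [⋀^Fin 2]→ₗ[SmoothFn E M] SmoothFn E M) :
    N [⋀^Fin 2]→ₗ[SmoothFn E M] SmoothFn E M :=
  altOfBilin
    (LinearMap.mk₂ (SmoothFn E M)
      (fun m n => L.anchor.der a (P ![m, n]) - P ![L.lieDeriv p a m, n] - P ![m, L.lieDeriv p a n])
      (fun m m' n => by
        simp only [L.lieDeriv_add, alt_add_left, map_add]
        abel)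
      (fun f m n => by
        simp only [L.lieDeriv_smul, alt_add_left, alt_smul_left, smul_eq_mul, Derivation.leibniz]
        ring)
      (fun m n n' => by
        simp only [L.lieDeriv_add, alt_add_right, map_add]
        abel)
      (fun f m n => by
        simp only [L.lieDeriv_smul, alt_add_right, alt_smul_right, smul_eq_mul, Derivation.leibniz]
        ring))
    (fun n => by
      simp only [LinearMap.mk₂_apply, alt_self, map_zero, zero_sub]
      rw [alt_skew P (L.lieDeriv p a n) n]
      abel)

/-- The Schouten bracket `[P, a] = -[a, P]` of a `2`-vector with a section. -/
noncomputable def schoutenRight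
    (p : SmoothSec E F V →ₗ[SmoothFn E M] N →ₗ[SmoothFn E M] SmoothFn E M)
    [p.IsPerfPair] (P : N [⋀^Fin 2]→ₗ[SmoothFn E M] SmoothFn E M) (a : SmoothSec E F V) :
    N [⋀^Fin 2]→ₗ[SmoothFn E M] SmoothFn E M :=
  -L.schouten p a P

end LieAlgebroid
end Algebroid

section Bialgebroid

variable {E : Type*} [NormedAddCommGroup E] [NormedSpace ℝ E] [FiniteDimensional ℝ E]
  {M : Type*} [TopologicalSpace M] [ChartedSpace E M] [IsManifold 𝓘(ℝ, E) ∞ M] [T2Space M]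
  {F : Type*} [NormedAddCommGroup F] [NormedSpace ℝ F] [FiniteDimensional ℝ F]
  {A : M → Type*} [TopologicalSpace (TotalSpace F A)]
  [∀ x, AddCommGroup (A x)] [∀ x, Module ℝ (A x)] [∀ x, TopologicalSpace (A x)]
  [FiberBundle F A] [VectorBundle ℝ F A] [ContMDiffVectorBundle ∞ F A 𝓘(ℝ, E)]

/-- The condition `d_{A*}[a₁, a₂] = [d_{A*} a₁, a₂] + [a₁, d_{A*} a₂]` for two sections of `A`.
For `a ∈ Γ(A)`, viewed as a `1`-form on `A*`, `d_{A*} a` is a `2`-form on `A*`, hence a section of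
`Λ² A`. -/
def DerivationIdentity (L : LieAlgebroid E F A)
    (L' : LieAlgebroid E (F →L[ℝ] ℝ) (DualBundle A)) (a₁ a₂ : SmoothSec E F A) : Prop :=
  L'.dForm pairing.flip (L.bracket a₁ a₂) =
    L.schoutenRight pairing (L'.dForm pairing.flip a₁) a₂ +
      L.schouten pairing a₁ (L'.dForm pairing.flip a₂)

/-- `(A, A*)` is a Lie bialgebroid. -/
def IsLieBialgebroid (L : LieAlgebroid E F A)
    (L' : LieAlgebroid E (F →L[ℝ] ℝ) (DualBundle A)) : Prop :=
  ∀ a₁ a₂ : SmoothSec E F A, DerivationIdentity L L' a₁ a₂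

/-- `[ρ(a), ρ_*(α)](f) - ρ_*(£_a α)(f) + ρ(£_α a)(f) - ρ_*(d_A f)⟨a, α⟩ = 0` -/
def AnchorIdentity (L : LieAlgebroid E F A)
    (L' : LieAlgebroid E (F →L[ℝ] ℝ) (DualBundle A)) (a : SmoothSec E F A)
    (α : SmoothSec E (F →L[ℝ] ℝ) (DualBundle A)) (f : SmoothFn E M) : Prop :=
  ⁅L.anchor.der a, L'.anchor.der α⁆ f - L'.anchor.der (L.lieDeriv pairing a α) f +
    L.anchor.der (L'.lieDeriv pairing.flip α a) f -
    L'.anchor.der (L.dFn pairing f) (pairing a α) = 0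

/-- `-ρ ∘ ρ_*^* = ρ_* ∘ ρ^*` as maps `T*M → TM`, where `ρ^* : T*M → A*` and
`ρ_*^* : T*M → A** = A`. -/
def AnchorsSkew (L : LieAlgebroid E F A)
    (L' : LieAlgebroid E (F →L[ℝ] ℝ) (DualBundle A)) : Prop :=
  ∀ (x : M) (ξ : TangentSpace 𝓘(ℝ, E) x →L[ℝ] ℝ),
    -L.anchor.map x (bidualToFiber F x (L'.anchor.transpose x ξ)) =
      L'.anchor.map x (L.anchor.transpose x ξ)

end Bialgebroid

end LieAlgd

namespace LieAlgd

/-! ### Leibniz rules for the Cartan calculus of one Lie algebroid -/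

section Algebroid

variable {E : Type*} [NormedAddCommGroup E] [NormedSpace ℝ E]
  {M : Type*} [TopologicalSpace M] [ChartedSpace E M] [IsManifold 𝓘(ℝ, E) ∞ M]
  {F : Type*} [NormedAddCommGroup F] [NormedSpace ℝ F]
  {V : M → Type*} [TopologicalSpace (TotalSpace F V)]
  [∀ x, AddCommGroup (V x)] [∀ x, Module ℝ (V x)] [∀ x, TopologicalSpace (V x)]
  [FiberBundle F V] [VectorBundle ℝ F V]
  {N : Type*} [AddCommGroup N] [Module (SmoothFn E M) N]

namespace LieAlgebroid

variable (L : LieAlgebroid E F V)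

/-! Write D(a, b) for the failure of the derivation identity (`derivationDefect`), W(a, α, f) for
the left side of (B2) (`anchorDefect`), and Q(f, g) = ρ_*(d_A f)(g) + ρ_*(d_A g)(f) (`anchorSymm`).
Each of these measures how far the previous one is from being linear over functions: D(a, f b)(α, β)
= f D(a, b)(α, β) - W(a, α, f)⟨b, β⟩ + W(a, β, f)⟨b, α⟩ (`derivationDefect_smul_right`), W(g a, α,
f) = g W(a, α, f) - ⟨a, α⟩ Q(f, g) (`anchorDefect_smul`). Moreover Q(f, g) is dg applied to (ρ_* ∘
ρ^* + ρ ∘ ρ_*^*)(df), so Q vanishes exactly when (B3) holds (`anchorsSkew_iff`).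

If (B1)-(B3) hold on a spanning set, the chain is read from the bottom up: Q = 0 makes W linear in
a, hence W = 0 for all sections, hence D is linear in each argument, and D = 0.

For a Lie bialgebroid of rank at least two it is read from the top down: D = 0 leaves W(a, α, f)⟨b,
β⟩ = W(a, β, f)⟨b, α⟩, and at each point some b is annihilated by α but not by a suitable β, so W =
0; a nonzero pairing ⟨a, α⟩ then gives Q = 0. In rank one Λ²A = 0, so D = 0 carries no information
and this step breaks down. In rank zero all sections vanish and (B2), (B3) are trivial. -/

theorem dForm_apply (p : SmoothSec E F V →ₗ[SmoothFn E M] N →ₗ[SmoothFn E M] SmoothFn E M)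
    (n : N) (a b : SmoothSec E F V) :
    L.dForm p n ![a, b] =
      L.anchor.der a (p b n) - L.anchor.der b (p a n) - p (L.bracket a b) n := rfl

theorem dForm_add (p : SmoothSec E F V →ₗ[SmoothFn E M] N →ₗ[SmoothFn E M] SmoothFn E M)
    (m n : N) (a b : SmoothSec E F V) :
    L.dForm p (m + n) ![a, b] = L.dForm p m ![a, b] + L.dForm p n ![a, b] := by
  simp only [dForm_apply, map_add]
  abel

theorem dForm_smul (p : SmoothSec E F V →ₗ[SmoothFn E M] N →ₗ[SmoothFn E M] SmoothFn E M)
    (f : SmoothFn E M) (n : N) (a b : SmoothSec E F V) :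
    L.dForm p (f • n) ![a, b] = f * L.dForm p n ![a, b] +
      (L.anchor.der a f * p b n - L.anchor.der b f * p a n) := by
  simp only [dForm_apply, map_smul, smul_eq_mul, Derivation.leibniz]
  ring

variable (p : SmoothSec E F V →ₗ[SmoothFn E M] N →ₗ[SmoothFn E M] SmoothFn E M) [p.IsPerfPair]

theorem schouten_apply (a : SmoothSec E F V) (P : N [⋀^Fin 2]→ₗ[SmoothFn E M] SmoothFn E M)
    (m n : N) :
    L.schouten p a P ![m, n] = L.anchor.der a (P ![m, n]) - P ![L.lieDeriv p a m, n] -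
      P ![m, L.lieDeriv p a n] := rfl

theorem schoutenRight_apply (a : SmoothSec E F V) (P : N [⋀^Fin 2]→ₗ[SmoothFn E M] SmoothFn E M)
    (m n : N) :
    L.schoutenRight p P a ![m, n] = -L.schouten p a P ![m, n] := rfl

theorem add_lieDeriv (a b : SmoothSec E F V) (n : N) :
    L.lieDeriv p (a + b) n = L.lieDeriv p a n + L.lieDeriv p b n := by
  refine p.flip.toPerfPair.injective (LinearMap.ext fun c => ?_)
  change p c (L.lieDeriv p (a + b) n) = p c (L.lieDeriv p a n + L.lieDeriv p b n)
  simp only [map_add, LinearMap.add_apply, Derivation.add_apply, L.pairing_lieDeriv]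
  abel

/-- The anchor term in the bracket of f a with c is ρ(c)(f) a; paired with n it becomes the value on
c of ⟨a, n⟩ df. All occurrences of d_A f in the anchor identity originate here. -/
theorem smul_lieDeriv (f : SmoothFn E M) (a : SmoothSec E F V) (n : N) :
    L.lieDeriv p (f • a) n = f • L.lieDeriv p a n + p a n • L.dFn p f := by
  refine p.flip.toPerfPair.injective (LinearMap.ext fun c => ?_)
  change p c (L.lieDeriv p (f • a) n) = p c (f • L.lieDeriv p a n + p a n • L.dFn p f)
  simp only [map_add, map_smul, map_sub, LinearMap.sub_apply, LinearMap.smul_apply,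
    Derivation.smul_apply, smul_eq_mul, L.pairing_lieDeriv, L.pairing_dFn, L.smul_bracket]
  ring

theorem add_schouten (a b : SmoothSec E F V) (P : N [⋀^Fin 2]→ₗ[SmoothFn E M] SmoothFn E M)
    (m n : N) :
    L.schouten p (a + b) P ![m, n] = L.schouten p a P ![m, n] + L.schouten p b P ![m, n] := by
  simp only [schouten_apply, add_lieDeriv, alt_add_left, alt_add_right, map_add,
    Derivation.add_apply]
  abel

/-- The correction is -a ∧ ι_{df} P: each of the two Lie derivatives contributes one copy of df,
inserted into one slot of P. -/
theorem smul_schouten (f : SmoothFn E M) (a : SmoothSec E F V)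
    (P : N [⋀^Fin 2]→ₗ[SmoothFn E M] SmoothFn E M) (m n : N) :
    L.schouten p (f • a) P ![m, n] = f * L.schouten p a P ![m, n] -
      (p a m * P ![L.dFn p f, n] - p a n * P ![L.dFn p f, m]) := by
  rw [alt_skew P (L.dFn p f) m]
  simp only [schouten_apply, smul_lieDeriv, alt_add_left, alt_add_right, alt_smul_left,
    alt_smul_right, map_smul, Derivation.smul_apply, smul_eq_mul]
  ring

end LieAlgebroid
end Algebroid

/-! ### The three defects and their dependence on functions -/

section Bialgebroid

variable {E : Type*} [NormedAddCommGroup E] [NormedSpace ℝ E] [FiniteDimensional ℝ E]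
  {M : Type*} [TopologicalSpace M] [ChartedSpace E M] [IsManifold 𝓘(ℝ, E) ∞ M] [T2Space M]
  {F : Type*} [NormedAddCommGroup F] [NormedSpace ℝ F] [FiniteDimensional ℝ F]
  {A : M → Type*} [TopologicalSpace (TotalSpace F A)]
  [∀ x, AddCommGroup (A x)] [∀ x, Module ℝ (A x)] [∀ x, TopologicalSpace (A x)]
  [FiberBundle F A] [VectorBundle ℝ F A] [ContMDiffVectorBundle ∞ F A 𝓘(ℝ, E)]
  (L : LieAlgebroid E F A) (L' : LieAlgebroid E (F →L[ℝ] ℝ) (DualBundle A))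

/-- The failure of `d_{A*}` to be a derivation of the bracket on `a` and `b`, evaluated at
`(α, β)`. -/
noncomputable def derivationDefect (a b : SmoothSec E F A)
    (α β : SmoothSec E (F →L[ℝ] ℝ) (DualBundle A)) : SmoothFn E M :=
  L'.dForm pairing.flip (L.bracket a b) ![α, β] +
    L.schouten pairing b (L'.dForm pairing.flip a) ![α, β] -
    L.schouten pairing a (L'.dForm pairing.flip b) ![α, β]

/-- The left-hand side of the anchor identity. -/
noncomputable def anchorDefect (a : SmoothSec E F A)
    (α : SmoothSec E (F →L[ℝ] ℝ) (DualBundle A)) (f : SmoothFn E M) : SmoothFn E M :=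
  ⁅L.anchor.der a, L'.anchor.der α⁆ f - L'.anchor.der (L.lieDeriv pairing a α) f +
    L.anchor.der (L'.lieDeriv pairing.flip α a) f -
    L'.anchor.der (L.dFn pairing f) (pairing a α)

/-- The symmetric expression `ρ_*(d_A f)(g) + ρ_*(d_A g)(f)`. -/
noncomputable def anchorSymm (f g : SmoothFn E M) : SmoothFn E M :=
  L'.anchor.der (L.dFn (pairing (V := A)) f) g + L'.anchor.der (L.dFn (pairing (V := A)) g) f

theorem derivationIdentity_iff (a b : SmoothSec E F A) :
    DerivationIdentity L L' a b ↔ ∀ α β, derivationDefect L L' a b α β = 0 := by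
  constructor
  · intro h α β
    have := congrArg (fun P => P ![α, β]) h
    simp only [AlternatingMap.add_apply, LieAlgebroid.schoutenRight_apply] at this
    rw [derivationDefect, this]
    ring
  · intro h
    refine AlternatingMap.ext fun v => ?_
    have hv : v = ![v 0, v 1] := by
      ext i
      fin_cases i <;> rfl
    rw [hv]
    have := h (v 0) (v 1)
    rw [derivationDefect] at this
    simp only [AlternatingMap.add_apply, LieAlgebroid.schoutenRight_apply]
    linear_combination this

/-- The bracket is skew and the two Schouten terms trade places. Linearity therefore needs to be
studied in the second argument only. -/
theorem derivationDefect_skew (a b : SmoothSec E F A)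
    (α β : SmoothSec E (F →L[ℝ] ℝ) (DualBundle A)) :
    derivationDefect L L' b a α β = -derivationDefect L L' a b α β := by
  simp only [derivationDefect, L.bracket_skew a b, LieAlgebroid.dForm_apply, map_neg,
    LinearMap.flip_apply]
  ring

theorem derivationDefect_add_right (a b c : SmoothSec E F A)
    (α β : SmoothSec E (F →L[ℝ] ℝ) (DualBundle A)) :
    derivationDefect L L' a (b + c) α β =
      derivationDefect L L' a b α β + derivationDefect L L' a c α β := by
  simp only [derivationDefect, map_add, LieAlgebroid.dForm_add, LieAlgebroid.add_schouten]
  -- Additivity in the section was used with the Schouten bracket still folded; additivity in the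
  -- 2-vector shows only after unfolding it.
  simp only [LieAlgebroid.schouten_apply, LieAlgebroid.dForm_add, map_add]
  ring

/-- This is Cartan's formula for ι_{d_A f} d_{A*} a. It turns the correction term of `smul_schouten`
into the last two terms of the anchor identity. -/
theorem dForm_dFn_apply (a : SmoothSec E F A)
    (α : SmoothSec E (F →L[ℝ] ℝ) (DualBundle A)) (f : SmoothFn E M) :
    L'.dForm pairing.flip a ![L.dFn pairing f, α] =
      L'.anchor.der (L.dFn pairing f) (pairing a α) -
        L.anchor.der (L'.lieDeriv pairing.flip α a) f := by
  have h := L'.pairing_lieDeriv pairing.flip α (L.dFn pairing f) a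
  simp only [LinearMap.flip_apply, L.pairing_dFn] at h
  rw [h, LieAlgebroid.dForm_apply, L'.bracket_skew α]
  simp only [LinearMap.flip_apply, L.pairing_dFn, map_neg,
    LinearMap.neg_apply]
  ring

/-- In the expansion the terms ρ(a)(f) d_{A*} b and d_{A*} f ∧ [a, b] cancel. What is left is
(d_{A*}(ρ(a) f) - £_a d_{A*} f + ι_{d_A f} d_{A*} a) ∧ b, whose first factor is α ↦ -W(a, α, f). -/
theorem derivationDefect_smul_right (a b : SmoothSec E F A) (f : SmoothFn E M)
    (α β : SmoothSec E (F →L[ℝ] ℝ) (DualBundle A)) :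
    derivationDefect L L' a (f • b) α β = f * derivationDefect L L' a b α β -
      anchorDefect L L' a α f * pairing b β + anchorDefect L L' a β f * pairing b α := by
  simp only [derivationDefect, L.leibniz, LieAlgebroid.dForm_add, LieAlgebroid.dForm_smul,
    LieAlgebroid.smul_schouten, dForm_dFn_apply]
  simp only [LieAlgebroid.schouten_apply, LieAlgebroid.dForm_smul, map_add, map_sub,
    Derivation.leibniz, smul_eq_mul, LinearMap.flip_apply, L.pairing_lieDeriv, anchorDefect,
    Derivation.commutator_apply]
  ring

theorem anchorDefect_add (a b : SmoothSec E F A)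
    (α : SmoothSec E (F →L[ℝ] ℝ) (DualBundle A)) (f : SmoothFn E M) :
    anchorDefect L L' (a + b) α f = anchorDefect L L' a α f + anchorDefect L L' b α f := by
  simp only [anchorDefect, Derivation.commutator_apply, map_add, Derivation.add_apply,
    LieAlgebroid.add_lieDeriv, LieAlgebroid.lieDeriv_add, LinearMap.add_apply]
  ring

/-- The terms ρ_*(α)(g) ρ(a)(f) from the commutator and from £_α(g a) cancel. Two non-linear terms
survive: ρ_*(d_A g)(f) from £_{g a} α, and ρ_*(d_A f)(g) from the last summand, both multiplied by
⟨a, α⟩. -/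
theorem anchorDefect_smul (a : SmoothSec E F A) (g : SmoothFn E M)
    (α : SmoothSec E (F →L[ℝ] ℝ) (DualBundle A)) (f : SmoothFn E M) :
    anchorDefect L L' (g • a) α f =
      g * anchorDefect L L' a α f - pairing a α * anchorSymm L L' f g := by
  simp only [anchorDefect, anchorSymm, Derivation.commutator_apply, map_add, Derivation.add_apply,
    LieAlgebroid.smul_lieDeriv, LieAlgebroid.lieDeriv_smul, LinearMap.smul_apply, map_smul,
    Derivation.smul_apply, smul_eq_mul, Derivation.leibniz]
  ring

end Bialgebroid

/-! ### Covectors as differentials of global functions -/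

section Cotangent

variable {E : Type*} [NormedAddCommGroup E] [NormedSpace ℝ E] [FiniteDimensional ℝ E]
  {M : Type*} [TopologicalSpace M] [ChartedSpace E M] [IsManifold 𝓘(ℝ, E) ∞ M] [T2Space M]

/-- Every covector is the differential of a global smooth function. -/
theorem exists_mfderiv_eq (x : M) (ξ : TangentSpace 𝓘(ℝ, E) x →L[ℝ] ℝ) :
    ∃ f : SmoothFn E M, ∀ v : TangentSpace 𝓘(ℝ, E) x, mfderiv 𝓘(ℝ, E) 𝓘(ℝ, ℝ) f x v = ξ v := by
  have hx : x ∈ (extChartAt 𝓘(ℝ, E) x).source := mem_extChartAt_source x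
  obtain ⟨e, he⟩ := isInvertible_mfderiv_extChartAt (I := 𝓘(ℝ, E)) hx
  -- The form ξ is transported through the derivative of the chart at x, so that η composed with the
  -- chart has differential ξ there; a cutoff then makes this function global.
  let η : E →L[ℝ] ℝ := ξ.comp e.symm.toContinuousLinearMap
  have hsm : ∀ y ∈ (chartAt E x).source, ContMDiffAt 𝓘(ℝ, E) 𝓘(ℝ, ℝ) ∞
      (fun y => η (extChartAt 𝓘(ℝ, E) x y)) y := fun y hy =>
    η.contMDiff.contMDiffAt.comp y (contMDiffAt_extChartAt' hy)
  obtain ⟨f, hf⟩ := exists_fn (E := E) (chartAt E x).open_source (mem_chart_source E x) hsm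
  refine ⟨f, fun v => ?_⟩
  have h1 : HasMFDerivAt 𝓘(ℝ, E) 𝓘(ℝ, ℝ) (fun y => η (extChartAt 𝓘(ℝ, E) x y)) x
      (η.comp (mfderiv 𝓘(ℝ, E) 𝓘(ℝ, E) (extChartAt 𝓘(ℝ, E) x) x)) :=
    (η.hasMFDerivAt (x := extChartAt 𝓘(ℝ, E) x x)).comp x
      (mdifferentiableAt_extChartAt (mem_chart_source E x)).hasMFDerivAt
  have h2 := (h1.congr_of_eventuallyEq hf).mfderiv
  refine (congrArg (fun T => T v) h2).trans ?_
  change ξ (e.symm (mfderiv 𝓘(ℝ, E) 𝓘(ℝ, E) (extChartAt 𝓘(ℝ, E) x) x v)) = ξ v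
  rw [← he]
  exact congrArg ξ (e.symm_apply_apply v)

/-- The differentials of global smooth functions separate tangent vectors. -/
theorem tangent_ext {x : M} {v w : TangentSpace 𝓘(ℝ, E) x}
    (h : ∀ f : SmoothFn E M, mfderiv 𝓘(ℝ, E) 𝓘(ℝ, ℝ) f x v = mfderiv 𝓘(ℝ, E) 𝓘(ℝ, ℝ) f x w) :
    v = w := by
  -- The tangent space is definitionally the normed space E, whose continuous dual separates points.
  have key : ∀ ξ : E →L[ℝ] ℝ, ξ v = ξ w := fun ξ => by
    obtain ⟨f, hf⟩ := exists_mfderiv_eq (E := E) x ξ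
    exact (hf v).symm.trans ((h f).trans (hf w))
  exact (SeparatingDual.eq_iff_forall_dual_eq (R := ℝ) (V := E)).2 key

end Cotangent

/-! ### Sections and fibres according to the rank -/

section Rank

variable {E : Type*} [NormedAddCommGroup E] [NormedSpace ℝ E]
  {M : Type*} [TopologicalSpace M] [ChartedSpace E M]
  {F : Type*} [NormedAddCommGroup F] [NormedSpace ℝ F] [FiniteDimensional ℝ F]
  {V : M → Type*} [TopologicalSpace (TotalSpace F V)]
  [∀ x, AddCommGroup (V x)] [∀ x, Module ℝ (V x)] [∀ x, TopologicalSpace (V x)]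
  [FiberBundle F V] [VectorBundle ℝ F V]

/-- In rank zero all sections vanish. -/
theorem subsingleton_sec (hF : Module.finrank ℝ F = 0) : Subsingleton (SmoothSec E F V) := by
  have : Subsingleton F := Module.finrank_zero_iff.1 hF
  refine ⟨fun a b => ?_⟩
  ext x
  exact (VectorBundle.continuousLinearEquivAt ℝ F V x).injective (Subsingleton.elim _ _)

theorem finrank_dual_eq_zero (hF : Module.finrank ℝ F = 0) :
    Module.finrank ℝ (F →L[ℝ] ℝ) = 0 := by
  have : Subsingleton F := Module.finrank_zero_iff.1 hF
  exact Module.finrank_zero_of_subsingleton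

/-- In rank at least two, every linear form on a fibre has a nonzero vector in its kernel. -/
theorem exists_apply_eq_zero_of_one_lt_finrank (hF : 1 < Module.finrank ℝ F) (x : M)
    (α : DualBundle V x) : ∃ (b : V x) (β : DualBundle V x), α b = 0 ∧ β b ≠ 0 := by
  -- The fibre carries only a topology; its properties are transported from F so that every linear
  -- form on it is continuous.
  have : T2Space (V x) := FiberBundle.t2Space F V x
  have : FiniteDimensional ℝ (V x) := VectorBundle.finiteDimensional ℝ F V x
  let e := VectorBundle.continuousLinearEquivAt ℝ F V x
  have : IsTopologicalAddGroup (V x) := e.toContinuousAddEquiv.isTopologicalAddGroup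
  have : ContinuousSMul ℝ (V x) := e.continuousSMul
  have hfr : Module.finrank ℝ ℝ < Module.finrank ℝ (V x) := by
    rwa [e.toLinearEquiv.finrank_eq, Module.finrank_self]
  obtain ⟨b, hb, hb0⟩ := (Submodule.ne_bot_iff _).1
    (LinearMap.ker_ne_bot_of_finrank_lt (f := α.toLinearMap) hfr)
  obtain ⟨φ, hφ⟩ := not_forall.1 fun h => hb0 ((Module.forall_dual_apply_eq_zero_iff ℝ b).1 h)
  exact ⟨b, LinearMap.toContinuousLinearMap φ, hb, hφ⟩

end Rank

/-! ### The skewness condition in terms of functions, and the two implications -/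

section Bialgebroid

variable {E : Type*} [NormedAddCommGroup E] [NormedSpace ℝ E] [FiniteDimensional ℝ E]
  {M : Type*} [TopologicalSpace M] [ChartedSpace E M] [IsManifold 𝓘(ℝ, E) ∞ M] [T2Space M]
  {F : Type*} [NormedAddCommGroup F] [NormedSpace ℝ F] [FiniteDimensional ℝ F]
  {A : M → Type*} [TopologicalSpace (TotalSpace F A)]
  [∀ x, AddCommGroup (A x)] [∀ x, Module ℝ (A x)] [∀ x, TopologicalSpace (A x)]
  [FiberBundle F A] [VectorBundle ℝ F A] [ContMDiffVectorBundle ∞ F A 𝓘(ℝ, E)]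
  (L : LieAlgebroid E F A) (L' : LieAlgebroid E (F →L[ℝ] ℝ) (DualBundle A))

theorem dFn_apply (f : SmoothFn E M) (x : M) :
    L.dFn (pairing (V := A)) f x =
      L.anchor.transpose x (mfderiv 𝓘(ℝ, E) 𝓘(ℝ, ℝ) f x) := by
  ext v
  obtain ⟨a, rfl⟩ := exists_sec_eq (E := E) (F := F) x v
  exact congrArg (fun g : SmoothFn E M => g x) (L.pairing_dFn pairing f a)

/-- Transposing twice moves the roles of f and g: df(ρ_*(ρ^* dg)) = (ρ_*^* df)(ρ^* dg) = dg(ρ(ρ_*^*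
df)). Both summands thus become dg of a vector depending only on df. -/
theorem anchorSymm_apply (f g : SmoothFn E M) (x : M) :
    anchorSymm L L' f g x =
      mfderiv 𝓘(ℝ, E) 𝓘(ℝ, ℝ) g x
        (L'.anchor.map x (L.anchor.transpose x (mfderiv 𝓘(ℝ, E) 𝓘(ℝ, ℝ) f x))) +
      mfderiv 𝓘(ℝ, E) 𝓘(ℝ, ℝ) g x
        (L.anchor.map x (bidualToFiber F x
          (L'.anchor.transpose x (mfderiv 𝓘(ℝ, E) 𝓘(ℝ, ℝ) f x)))) := by
  have h := apply_bidualToFiber F x (L'.anchor.transpose x (mfderiv 𝓘(ℝ, E) 𝓘(ℝ, ℝ) f x))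
    (L.anchor.transpose x (mfderiv 𝓘(ℝ, E) 𝓘(ℝ, ℝ) g x))
  have h1 : mfderiv 𝓘(ℝ, E) 𝓘(ℝ, ℝ) g x (L.anchor.map x (bidualToFiber F x
      (L'.anchor.transpose x (mfderiv 𝓘(ℝ, E) 𝓘(ℝ, ℝ) f x)))) =
      mfderiv 𝓘(ℝ, E) 𝓘(ℝ, ℝ) f x (L'.anchor.map x (L.dFn (pairing (V := A)) g x)) := by
    rw [dFn_apply]
    exact h
  rw [h1, ← dFn_apply]
  rfl

/-- Differentials of global functions exhaust the covectors at a point and separate its tangent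
vectors, so testing on all f and g loses nothing. -/
theorem anchorsSkew_iff :
    AnchorsSkew L L' ↔ ∀ f g : SmoothFn E M, anchorSymm L L' f g = 0 := by
  constructor
  · intro h f g
    ext x
    rw [anchorSymm_apply, ← h x (mfderiv 𝓘(ℝ, E) 𝓘(ℝ, ℝ) f x), map_neg]
    exact neg_add_cancel _
  · intro h x ξ
    obtain ⟨f, hf⟩ := exists_mfderiv_eq (E := E) x ξ
    obtain rfl : mfderiv 𝓘(ℝ, E) 𝓘(ℝ, ℝ) f x = ξ := ContinuousLinearMap.ext hf
    refine tangent_ext fun g => ?_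
    have h1 := anchorSymm_apply L L' f g x
    rw [h f g] at h1
    rw [map_neg]
    exact (eq_neg_of_add_eq_zero_left h1.symm).symm

/-- The three conditions on a spanning set imply that `(A, A*)` is a Lie bialgebroid. -/
theorem isLieBialgebroid_of_span {S : Set (SmoothSec E F A)}
    (hS : Submodule.span (SmoothFn E M) S = ⊤)
    (h1 : ∀ a₁ ∈ S, ∀ a₂ ∈ S, DerivationIdentity L L' a₁ a₂)
    (h2 : ∀ a ∈ S, ∀ α f, AnchorIdentity L L' a α f) (h3 : AnchorsSkew L L') :
    IsLieBialgebroid L L' := by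
  rw [anchorsSkew_iff] at h3
  have hW (a : SmoothSec E F A) : ∀ α f, anchorDefect L L' a α f = 0 := by
    induction (hS ▸ Submodule.mem_top : a ∈ Submodule.span (SmoothFn E M) S)
      using Submodule.span_induction with
    | mem a ha => exact h2 a ha
    | zero =>
      intro α f
      -- Writing the zero section as 0 • 0 lets the scaling law give the vanishing.
      rw [← zero_smul (SmoothFn E M) (0 : SmoothSec E F A), anchorDefect_smul, h3]
      ring
    | add a b _ _ ha hb =>
      intro α f
      rw [anchorDefect_add, ha, hb, add_zero]
    | smul g a _ ha =>
      intro α f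
      rw [anchorDefect_smul, ha, h3]
      ring
  have hD (a : SmoothSec E F A) (ha : ∀ b ∈ S, ∀ α β, derivationDefect L L' a b α β = 0)
      (b : SmoothSec E F A) : ∀ α β, derivationDefect L L' a b α β = 0 := by
    induction (hS ▸ Submodule.mem_top : b ∈ Submodule.span (SmoothFn E M) S)
      using Submodule.span_induction with
    | mem b hb => exact ha b hb
    | zero =>
      intro α β
      rw [← zero_smul (SmoothFn E M) (0 : SmoothSec E F A), derivationDefect_smul_right, hW, hW]
      ring
    | add b c _ _ hb hc =>
      intro α β
      rw [derivationDefect_add_right, hb, hc, add_zero]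
    | smul g b _ hb =>
      intro α β
      rw [derivationDefect_smul_right, hb, hW, hW]
      ring
  intro a b
  rw [derivationIdentity_iff]
  -- `hD` extends the second argument from the spanning set to all sections. It is applied twice,
  -- with skewness exchanging the arguments in between.
  refine hD a (fun b hb α β => ?_) b
  rw [derivationDefect_skew, hD b (fun c hc => (derivationIdentity_iff L L' b c).1 (h1 b hb c hc)),
    neg_zero]

/-- The scaling law of the derivation defect, with both defects zero, is evaluated at x on b and β
chosen so that α_x(b_x) = 0 and β_x(b_x) ≠ 0; only the term with the anchor defect at α survives. -/
theorem anchorDefect_eq_zero (hF : 1 < Module.finrank ℝ F) (h : IsLieBialgebroid L L')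
    (a : SmoothSec E F A) (α : SmoothSec E (F →L[ℝ] ℝ) (DualBundle A)) (f : SmoothFn E M) :
    anchorDefect L L' a α f = 0 := by
  ext x
  obtain ⟨v, ξ, h0, h1⟩ := exists_apply_eq_zero_of_one_lt_finrank hF x (α x)
  obtain ⟨b, rfl⟩ := exists_sec_eq (E := E) (F := F) x v
  obtain ⟨β, rfl⟩ := exists_sec_eq (E := E) (F := F →L[ℝ] ℝ) (V := DualBundle A) x ξ
  have h2 := derivationDefect_smul_right L L' a b f α β
  rw [(derivationIdentity_iff L L' a _).1 (h a _), (derivationIdentity_iff L L' a b).1 (h a b)]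
    at h2
  have h3 := congrArg (fun g : SmoothFn E M => g x) h2
  have h4 : (0 : ℝ) = f x * 0 - anchorDefect L L' a α f x * β x (b x) +
    anchorDefect L L' a β f x * α x (b x) := h3
  refine (mul_eq_zero.1 ?_).resolve_right h1
  rw [h0] at h4
  linarith

theorem anchorSymm_eq_zero (hF : 1 < Module.finrank ℝ F) (h : IsLieBialgebroid L L')
    (f g : SmoothFn E M) : anchorSymm L L' f g = 0 := by
  ext x
  -- Only a vector and a form with nonzero pairing are wanted, so the kernel condition is taken for
  -- the zero form, where it is empty.
  obtain ⟨v, ξ, -, h1⟩ := exists_apply_eq_zero_of_one_lt_finrank (V := A) hF x 0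
  obtain ⟨b, rfl⟩ := exists_sec_eq (E := E) (F := F) x v
  obtain ⟨β, rfl⟩ := exists_sec_eq (E := E) (F := F →L[ℝ] ℝ) (V := DualBundle A) x ξ
  have h2 := anchorDefect_smul L L' b g β f
  rw [anchorDefect_eq_zero L L' hF h, anchorDefect_eq_zero L L' hF h] at h2
  have h3 : (0 : ℝ) = g x * 0 - β x (b x) * anchorSymm L L' f g x :=
    congrArg (fun k : SmoothFn E M => k x) h2
  refine (mul_eq_zero.1 ?_).resolve_left h1
  linarith

theorem anchorIdentity_of_finrank_eq_zero (hF : Module.finrank ℝ F = 0) (a : SmoothSec E F A)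
    (α : SmoothSec E (F →L[ℝ] ℝ) (DualBundle A)) (f : SmoothFn E M) :
    AnchorIdentity L L' a α f := by
  have h1 : Subsingleton (SmoothSec E F A) := subsingleton_sec hF
  have h2 : Subsingleton (SmoothSec E (F →L[ℝ] ℝ) (DualBundle A)) :=
    subsingleton_sec (finrank_dual_eq_zero hF)
  have h3 (b : SmoothSec E F A) : L.anchor.der b = 0 := by
    rw [Subsingleton.elim b 0, map_zero]
  have h4 (β : SmoothSec E (F →L[ℝ] ℝ) (DualBundle A)) : L'.anchor.der β = 0 := by
    rw [Subsingleton.elim β 0, map_zero]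
  simp [AnchorIdentity, h3, h4]

/-- Both summands of the symmetric expression are values of ρ_* on sections of A*, and the only such
section is zero. -/
theorem anchorsSkew_of_finrank_eq_zero (hF : Module.finrank ℝ F = 0) : AnchorsSkew L L' := by
  have h : Subsingleton (SmoothSec E (F →L[ℝ] ℝ) (DualBundle A)) :=
    subsingleton_sec (finrank_dual_eq_zero hF)
  refine (anchorsSkew_iff L L').2 fun f g => ?_
  have h4 (β : SmoothSec E (F →L[ℝ] ℝ) (DualBundle A)) : L'.anchor.der β = 0 := by
    rw [Subsingleton.elim β 0, map_zero]
  simp [anchorSymm, h4]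

end Bialgebroid
end LieAlgd

/-! ### Assembly of the equivalence -/

theorem proposition4p2
    {E : Type*} [NormedAddCommGroup E] [NormedSpace ℝ E] [FiniteDimensional ℝ E]
    {M : Type*} [TopologicalSpace M] [T2Space M] [ChartedSpace E M] [IsManifold 𝓘(ℝ, E) ∞ M]
    {F : Type*} [NormedAddCommGroup F] [NormedSpace ℝ F] [FiniteDimensional ℝ F]
    {A : M → Type*} [TopologicalSpace (TotalSpace F A)]
    [∀ x, AddCommGroup (A x)] [∀ x, Module ℝ (A x)] [∀ x, TopologicalSpace (A x)]
    [FiberBundle F A] [VectorBundle ℝ F A] [ContMDiffVectorBundle ∞ F A 𝓘(ℝ, E)]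
    (L : LieAlgd.LieAlgebroid E F A)
    (L' : LieAlgd.LieAlgebroid E (F →L[ℝ] ℝ) (LieAlgd.DualBundle A))
    (S : Set (LieAlgd.SmoothSec E F A))
    (hS : Submodule.span (LieAlgd.SmoothFn E M) S = ⊤) :
    (Module.finrank ℝ F ≠ 1 →
      (LieAlgd.IsLieBialgebroid L L' ↔
        (∀ a₁ ∈ S, ∀ a₂ ∈ S, LieAlgd.DerivationIdentity L L' a₁ a₂) ∧
        (∀ a ∈ S, ∀ (α : LieAlgd.SmoothSec E (F →L[ℝ] ℝ) (LieAlgd.DualBundle A))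
          (f : LieAlgd.SmoothFn E M), LieAlgd.AnchorIdentity L L' a α f) ∧
        LieAlgd.AnchorsSkew L L')) ∧
    ((∀ a₁ ∈ S, ∀ a₂ ∈ S, LieAlgd.DerivationIdentity L L' a₁ a₂) ∧
        (∀ a ∈ S, ∀ (α : LieAlgd.SmoothSec E (F →L[ℝ] ℝ) (LieAlgd.DualBundle A))
          (f : LieAlgd.SmoothFn E M), LieAlgd.AnchorIdentity L L' a α f) ∧
        LieAlgd.AnchorsSkew L L' →
      LieAlgd.IsLieBialgebroid L L') := by
  refine ⟨fun hF => ⟨fun h => ?_, fun h => LieAlgd.isLieBialgebroid_of_span L L' hS h.1 h.2.1 h.2.2⟩,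
    fun h => LieAlgd.isLieBialgebroid_of_span L L' hS h.1 h.2.1 h.2.2⟩
  refine ⟨fun a _ b _ => h a b, ?_⟩
  -- Rank zero is split off because it offers no nonzero pairing to divide by; there (B2) and (B3)
  -- hold without using the bialgebroid property.
  rcases Nat.lt_or_gt_of_ne hF with h0 | h2
  · have h0 := Nat.lt_one_iff.1 h0
    exact ⟨fun a _ => LieAlgd.anchorIdentity_of_finrank_eq_zero L L' h0 a,
      LieAlgd.anchorsSkew_of_finrank_eq_zero L L' h0⟩
  · exact ⟨fun a _ => LieAlgd.anchorDefect_eq_zero L L' h2 h a,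
      (LieAlgd.anchorsSkew_iff L L').2 (LieAlgd.anchorSymm_eq_zero L L' h2 h)⟩
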